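/- Let $R$ be a commutative noetherian ring, $\mathfrak a$ an ideal of $R$, and $M$ an $R$-module. Call a module $N$ over a commutative ring $S$ *minimax* if it has a finitely generated submodule $N'$ such that $N/N'$ is artinian. Call $M$ *locally minimax* if $M_{\mathfrak m}$ is a minimax $R_{\mathfrak m}$-module for every maximal ideal $\mathfrak m$ of $R$. Call an $R$-module $N$ *$\mathfrak a$-cofinite* if $\operatorname{Supp}_R(N)\subseteq V(\mathfrak a)$ and $\operatorname{Ext}^i_R(R/\mathfrak a,N)$ is a finitely generated $R$-module for every $i\ge 0$. Suppose that $M$ is locally minimax and $\operatorname{Supp}_R(M)\subseteq V(\mathfrak a)$. If $0:_M\mathfrak a=\{m\in M : am=0 \text{ for all } a\in\mathfrak a\}$ is finitely generated, then $M$ is $\mathfrak a$-cofinite and minimax. In particular, if there is an element $x\in\mathfrak a$ such that $0:_M x=\{m\in M : xm=0\}$ is $\mathfrak a$-cofinite, then $M$ is $\mathfrak a$-cofinite and minimax. -/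

import Mathlib

universe u v

open CategoryTheory

/-- `M` is minimax: it has a finitely generated submodule `N` with `M ⧸ N` artinian. -/
def IsMinimax (R : Type u) [CommRing R] (M : Type v) [AddCommGroup M] [Module R M] : Prop :=
  ∃ N : Submodule R M, N.FG ∧ IsArtinian R (M ⧸ N)

/-- `M` is locally minimax: for every maximal ideal `𝔪` of `R`, the localization `M_𝔪` is a
minimax module over the local ring `R_𝔪`. -/
def IsLocallyMinimax (R : Type u) [CommRing R] (M : Type v) [AddCommGroup M] [Module R M] :
    Prop :=
  ∀ (𝔪 : Ideal R) [𝔪.IsMaximal],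
    IsMinimax (Localization.AtPrime 𝔪) (LocalizedModule 𝔪.primeCompl M)

/-- `M` is `𝔞`-cofinite: `Supp M ⊆ V(𝔞)` and every `Ext^i_R(R/𝔞, M)` is a finitely generated
`R`-module. -/
def IsCofinite {R : Type u} [CommRing R] (𝔞 : Ideal R)
    (M : Type u) [AddCommGroup M] [Module R M] : Prop :=
  Module.support R M ⊆ PrimeSpectrum.zeroLocus (𝔞 : Set R) ∧
    ∀ i : ℕ, Module.Finite R
      (Abelian.Ext.{u} (ModuleCat.of R (R ⧸ 𝔞)) (ModuleCat.of R M) i)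

/-! Let `F n` be the submodule of `M` killed by `𝔞 ^ n`. Each `F n` is noetherian because `0 :_M 𝔞`
is, and the support condition makes the `F n` exhaust `M`. The ideals `J n = (F n : F (n + 1))`
increase, hence stabilize at some `J`. Local minimaxness forces every prime over `J` to be maximal,
so only finitely many maximal ideals contain `J`. Their local chain conditions glue to make some `M
⧸ F n` artinian (`exists_isArtinian_quotient_torsionFiltration`), so `M` is minimax.

For cofiniteness it remains to treat the artinian module `A = M ⧸ F n`, where `0 :_A 𝔞 = F (n + 1) ⧸
F n` is noetherian. `finite_ext_quotient_of_isArtinian` inducts on the degree and on submodules of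
`A`, splitting a module `C` along multiplication by `x ∈ 𝔞`. The degree step passes to `C ⧸ xC`, so
finiteness of `0 : 𝔞` must descend to quotients of artinian modules:
`isNoetherian_torsionBySet_quotient`. -/

namespace Submodule

/-! ### Colon submodules `(N : s)` -/

section Colon

variable {R : Type*} [CommRing R] {M : Type*} [AddCommGroup M] [Module R M]

/-- The elements `m` of a module such that `r • m ∈ N` for every `r ∈ s`. -/
def smulColon (s : Set R) (N : Submodule R M) : Submodule R M where
  carrier := {m | ∀ r ∈ s, r • m ∈ N}
  add_mem' ha hb r hr := by
    rw [smul_add]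
    exact N.add_mem (ha r hr) (hb r hr)
  zero_mem' r _ := by
    rw [smul_zero]
    exact N.zero_mem
  smul_mem' c m hm r hr := by
    rw [smul_comm]
    exact N.smul_mem c (hm r hr)

lemma mem_smulColon {s : Set R} {N : Submodule R M} {m : M} :
    m ∈ smulColon s N ↔ ∀ r ∈ s, r • m ∈ N := Iff.rfl

lemma smulColon_bot (s : Set R) : smulColon s (⊥ : Submodule R M) = torsionBySet R M s := by
  ext m
  simp [mem_smulColon]

lemma le_smulColon (s : Set R) (N : Submodule R M) : N ≤ smulColon s N :=
  fun _ hm r _ ↦ N.smul_mem r hm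

lemma smulColon_span (s : Set R) (N : Submodule R M) :
    smulColon (Ideal.span s : Set R) N = smulColon s N := by
  refine le_antisymm (fun m hm r hr ↦ hm r (Ideal.subset_span hr)) fun m hm r hr ↦ ?_
  have : Ideal.span s ≤ N.comap (LinearMap.toSpanSingleton R M m) :=
    Ideal.span_le.2 fun r hr ↦ hm r hr
  exact this hr

lemma map_mkQ_smulColon (s : Set R) (N : Submodule R M) :
    (smulColon s N).map N.mkQ = torsionBySet R (M ⧸ N) s := by
  ext y
  obtain ⟨m, rfl⟩ := N.mkQ_surjective y
  constructor
  · rintro ⟨m', hm', h⟩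
    rw [← h, mem_torsionBySet_iff]
    rintro ⟨r, hr⟩
    exact (Quotient.mk_eq_zero N).2 (hm' r hr)
  · intro h
    rw [mem_torsionBySet_iff] at h
    exact ⟨m, fun r hr ↦ (Quotient.mk_eq_zero N).1 (h ⟨r, hr⟩), rfl⟩

lemma isNoetherian_of_inf_ker_of_map {P : Type*} [AddCommGroup P] [Module R P]
    (D : Submodule R M) (f : M →ₗ[R] P) (hk : IsNoetherian R ↥(D ⊓ LinearMap.ker f))
    (hr : IsNoetherian R (D.map f)) : IsNoetherian R D := by
  let g : D →ₗ[R] D.map f := f.restrict fun x hx ↦ mem_map_of_mem hx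
  exact isNoetherian_of_range_eq_ker
    (inclusion (inf_le_left : D ⊓ LinearMap.ker f ≤ D)) g (by
      ext ⟨x, hx⟩
      simp [g, LinearMap.mem_ker, range_inclusion, Subtype.ext_iff])

/-- Multiplication by the generators of `a` maps `(N : a)` into a finite power of `N`, with kernel
in `0 :_M a`. -/
lemma isNoetherian_smulColon {a : Ideal R} (ha : a.FG) {N : Submodule R M}
    (hN : IsNoetherian R N) (h : IsNoetherian R (torsionBySet R M (a : Set R))) :
    IsNoetherian R (smulColon (a : Set R) N) := by
  obtain ⟨s, rfl⟩ := ha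
  let f : M →ₗ[R] (s → M) := LinearMap.pi fun r ↦ LinearMap.lsmul R M r
  refine isNoetherian_of_inf_ker_of_map _ f ?_ ?_
  · have h' : IsNoetherian R (smulColon (s : Set R) (⊥ : Submodule R M)) := by
      rw [← smulColon_span, smulColon_bot]
      exact h
    refine isNoetherian_of_le (?_ : _ ≤ smulColon (s : Set R) ⊥)
    rintro m ⟨-, hm⟩ r hr
    exact congr_fun (LinearMap.mem_ker.1 hm) ⟨r, hr⟩
  · refine isNoetherian_of_le (?_ : _ ≤ LinearMap.range (N.subtype.compLeft s))
    rintro _ ⟨m, hm, rfl⟩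
    exact ⟨fun r ↦ ⟨r.1 • m, hm r (subset_span r.2)⟩, rfl⟩

end Colon

/-! ### Torsion in quotients of artinian modules -/

section ArtinianQuotient

variable {R : Type*} [CommRing R] {M : Type*} [AddCommGroup M] [Module R M]

lemma isNoetherian_inf_torsionBy_pow (D : Submodule R M) (x : R)
    (h : IsNoetherian R ↥(D ⊓ torsionBy R M x)) (n : ℕ) :
    IsNoetherian R ↥(D ⊓ torsionBy R M (x ^ n)) := by
  induction n with
  | zero =>
    refine isNoetherian_of_le (?_ : _ ≤ (⊥ : Submodule R M))
    rintro m ⟨-, hm⟩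
    simpa using hm
  | succ n ih =>
    refine isNoetherian_of_inf_ker_of_map _ (LinearMap.lsmul R M x) ?_ ?_
    · refine isNoetherian_of_le (?_ : _ ≤ D ⊓ torsionBy R M x)
      rintro m ⟨hm, hx⟩
      exact ⟨hm.1, hx⟩
    · refine isNoetherian_of_le (?_ : _ ≤ D ⊓ torsionBy R M (x ^ n))
      rintro _ ⟨m, hm, rfl⟩
      refine ⟨D.smul_mem x hm.1, ?_⟩
      have h0 : x ^ (n + 1) • m = 0 := hm.2
      rwa [pow_succ, mul_smul] at h0

lemma exists_map_lsmul_pow_eq [IsArtinian R M] (B : Submodule R M) (x : R) :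
    ∃ n : ℕ, B.map (LinearMap.lsmul R M (x ^ n)) = B.map (LinearMap.lsmul R M (x ^ (n + 1))) := by
  let f : ℕ →o (Submodule R M)ᵒᵈ :=
    ⟨fun n ↦ OrderDual.toDual (B.map (LinearMap.lsmul R M (x ^ n))), monotone_nat_of_le_succ (by
      intro n
      rw [OrderDual.toDual_le_toDual]
      rintro _ ⟨b, hb, rfl⟩
      exact ⟨x • b, B.smul_mem x hb, by simp [pow_succ, mul_smul, smul_comm x]⟩)⟩
  obtain ⟨n, hn⟩ := IsArtinian.monotone_stabilizes f
  exact ⟨n, hn (n + 1) n.le_succ⟩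

/-- Induction on the generators. The submodule `C` lets the induction cut down to the elements
killed by a power of the generator just removed. -/
lemma isNoetherian_map_mkQ_inf_smulColon [IsArtinian R M] (s : Finset R) (B C : Submodule R M)
    (hBC : B ≤ C) (h : IsNoetherian R ↥(C ⊓ smulColon (s : Set R) ⊥)) :
    IsNoetherian R ((C ⊓ smulColon (s : Set R) B).map B.mkQ) := by
  classical
  induction s using Finset.induction_on generalizing B C with
  | empty =>
    have : IsNoetherian R C :=
      isNoetherian_of_le (le_inf le_rfl fun _ _ _ hr ↦ absurd hr (by simp) :
        C ≤ C ⊓ smulColon ((∅ : Finset R) : Set R) ⊥)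
    exact isNoetherian_of_le (map_mono inf_le_left : _ ≤ C.map B.mkQ)
  | insert x s _ ih =>
    obtain ⟨n, hn⟩ := exists_map_lsmul_pow_eq B x
    let C' := C ⊓ torsionBy R M (x ^ (n + 1))
    have hC' : IsNoetherian R ↥(C' ⊓ smulColon (s : Set R) ⊥) := by
      have := isNoetherian_inf_torsionBy_pow (C ⊓ smulColon (s : Set R) ⊥) x
        (isNoetherian_of_le (?_ : _ ≤ C ⊓ smulColon (insert x s : Finset R) ⊥)) (n + 1)
      · rwa [inf_right_comm] at this
      · rintro m ⟨⟨hm, hs⟩, hx⟩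
        refine ⟨hm, fun r hr ↦ ?_⟩
        rcases Finset.mem_insert.1 (Finset.mem_coe.1 hr) with rfl | hr
        exacts [(mem_bot R).2 hx, hs r hr]
    have key := ih (B ⊓ C') C' inf_le_right hC'
    have key' : IsNoetherian R ((C' ⊓ smulColon (s : Set R) (B ⊓ C')).map B.mkQ) := by
      have : B.mkQ = (B ⊓ C').mapQ B LinearMap.id inf_le_left ∘ₗ (B ⊓ C').mkQ := by
        ext; rfl
      rw [this, map_comp]
      infer_instance
    refine isNoetherian_of_le
      (?_ : _ ≤ (C' ⊓ smulColon (s : Set R) (B ⊓ C')).map B.mkQ)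
    rintro _ ⟨z, ⟨hzC, hz⟩, rfl⟩
    have hx : x • z ∈ B := hz x (by simp)
    -- Since `x ^ n B = x ^ (n + 1) B`, the class of `z` modulo `B` has a representative `z - b`
    -- killed by `x ^ (n + 1)`.
    have hmem : x ^ (n + 1) • z ∈ B.map (LinearMap.lsmul R M (x ^ n)) :=
      ⟨x • z, hx, by simp [pow_succ, mul_smul, smul_comm x]⟩
    rw [hn] at hmem
    obtain ⟨b, hb, hbz⟩ := hmem
    have hC : z - b ∈ C' := by
      refine ⟨C.sub_mem hzC (hBC hb), ?_⟩
      change x ^ (n + 1) • (z - b) = 0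
      rw [smul_sub, sub_eq_zero]
      exact hbz.symm
    refine ⟨z - b, ⟨hC, fun r hr ↦ ⟨?_, C'.smul_mem r hC⟩⟩, ?_⟩
    · rw [smul_sub]
      exact B.sub_mem (hz r (by simp [Finset.mem_coe.1 hr])) (B.smul_mem r hb)
    · rw [map_sub, sub_eq_self]
      exact (Quotient.mk_eq_zero B).2 hb

/-- If `M` is Artinian and the elements of `M` killed by `a` form a Noetherian module, then so do
the elements of any quotient of `M` killed by `a`. -/
theorem isNoetherian_torsionBySet_quotient [IsArtinian R M] {a : Ideal R} (ha : a.FG)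
    (h : IsNoetherian R (torsionBySet R M (a : Set R))) (B : Submodule R M) :
    IsNoetherian R (torsionBySet R (M ⧸ B) (a : Set R)) := by
  obtain ⟨s, rfl⟩ := ha
  rw [← smulColon_bot] at h
  have := isNoetherian_map_mkQ_inf_smulColon s B ⊤ le_top (by
    rw [top_inf_eq, ← smulColon_span]
    exact h)
  rw [top_inf_eq, ← smulColon_span] at this
  rwa [← map_mkQ_smulColon]

end ArtinianQuotient

end Submodule

/-! ### Chain conditions descended from a localization -/

section Localization

variable {R : Type*} [CommRing R] {M : Type*} [AddCommGroup M] [Module R M]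

/-- If `M` is minimax at the prime `p`, then some finitely generated submodule `N` is such that
decreasing chains of submodules containing `N` become stationary after localization at `p`. -/
lemma IsMinimax.exists_fg_forall_antitone {p : Ideal R} [p.IsPrime]
    (h : IsMinimax (Localization.AtPrime p) (LocalizedModule p.primeCompl M)) :
    ∃ N : Submodule R M, N.FG ∧ ∀ B : ℕ → Submodule R M, Antitone B → (∀ k, N ≤ B k) →
      ∃ n, ∀ k, n ≤ k → ∀ z ∈ B n, ∃ u ∉ p, u • z ∈ B k := by
  classical
  obtain ⟨N', ⟨s, hs⟩, hart⟩ := h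
  let f := LocalizedModule.mkLinearMap p.primeCompl M
  have hsurj := IsLocalizedModule.mk'_surjective p.primeCompl f
  choose g hg using hsurj
  -- Spanned by numerators of generators of `N'`, so its localization contains `N'`.
  refine ⟨Submodule.span R ((fun y ↦ (g y).1) '' (s : Set _)),
    ⟨s.image fun y ↦ (g y).1, by simp⟩, fun B hB hNB ↦ ?_⟩
  let B' : ℕ → Submodule (Localization.AtPrime p) (LocalizedModule p.primeCompl M) :=
    fun k ↦ (B k).localized' (Localization.AtPrime p) p.primeCompl f
  have hB' : Antitone B' := by
    intro i j hij x hx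
    obtain ⟨m, hm, t, rfl⟩ := hx
    exact ⟨m, hB hij hm, t, rfl⟩
  have hN' (k : ℕ) : N' ≤ B' k := by
    rw [← hs, Submodule.span_le]
    intro y hy
    exact ⟨(g y).1, hNB k (Submodule.subset_span ⟨y, hy, rfl⟩), (g y).2, hg y⟩
  let c : ℕ →o (Submodule (Localization.AtPrime p)
      (LocalizedModule p.primeCompl M ⧸ N'))ᵒᵈ :=
    ⟨fun k ↦ OrderDual.toDual ((B' k).map N'.mkQ), fun i j hij ↦ Submodule.map_mono (hB' hij)⟩
  obtain ⟨n, hn⟩ := IsArtinian.monotone_stabilizes c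
  refine ⟨n, fun k hk z hz ↦ ?_⟩
  have heq : B' n = B' k := by
    have h1 : (B' n).map N'.mkQ = (B' k).map N'.mkQ := hn k hk
    have h2 := congrArg (Submodule.comap N'.mkQ) h1
    simpa [Submodule.comap_map_mkQ, hN'] using h2
  have hz' : f z ∈ B' k := by
    rw [← heq]
    exact ⟨z, hz, 1, by simp⟩
  obtain ⟨w, hw, t, hwt⟩ := hz'
  rw [IsLocalizedModule.mk'_eq_iff] at hwt
  obtain ⟨c, hc⟩ := (IsLocalizedModule.eq_iff_exists p.primeCompl f).1
    (hwt.trans (f.map_smul (t : R) z).symm)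
  refine ⟨c * t, (c * t).2, ?_⟩
  have : ((c : R) * t) • z = (c : R) • w := by
    rw [mul_smul]
    exact hc.symm
  rw [this]
  exact (B k).smul_mem _ hw

end Localization

/-! ### The torsion filtration and its artinian quotient -/

section TorsionFiltration

variable {R : Type*} [CommRing R] {M : Type*} [AddCommGroup M] [Module R M]

namespace Submodule

variable (M) in
/-- The ascending filtration of `M` by the elements killed by the powers of `a`. -/
def torsionFiltration (a : Ideal R) : ℕ → Submodule R M
  | 0 => ⊥
  | n + 1 => smulColon (a : Set R) (torsionFiltration a n)

lemma torsionFiltration_mono (a : Ideal R) : Monotone (torsionFiltration M a) :=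
  monotone_nat_of_le_succ fun _ ↦ le_smulColon _ _

lemma mem_torsionFiltration {a : Ideal R} {n : ℕ} {m : M} (h : ∀ r ∈ a ^ n, r • m = 0) :
    m ∈ torsionFiltration M a n := by
  induction n generalizing m with
  | zero => simpa [torsionFiltration] using h 1 (by simp)
  | succ n ih =>
    refine fun r hr ↦ ih fun t ht ↦ ?_
    rw [← mul_smul]
    exact h _ (by rw [pow_succ]; exact Ideal.mul_mem_mul ht hr)

lemma isNoetherian_torsionFiltration {a : Ideal R} (ha : a.FG)
    (h : IsNoetherian R (torsionBySet R M (a : Set R))) (n : ℕ) :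
    IsNoetherian R (torsionFiltration M a n) := by
  induction n with
  | zero => exact inferInstanceAs (IsNoetherian R (⊥ : Submodule R M))
  | succ n ih => exact isNoetherian_smulColon ha ih h

/-- If the support of `M` lies in `V(a)`, the torsion filtration is exhaustive. -/
lemma exists_mem_torsionFiltration {a : Ideal R} (ha : a.FG)
    (hsupp : Module.support R M ⊆ PrimeSpectrum.zeroLocus (a : Set R)) (m : M) :
    ∃ n, m ∈ torsionFiltration M a n := by
  have hle : a ≤ (span R {m}).annihilator.radical := by
    rw [Ideal.radical_eq_sInf]
    refine le_sInf fun p ⟨hp, hprime⟩ ↦ ?_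
    have : (⟨p, hprime⟩ : PrimeSpectrum R) ∈ Module.support R M :=
      Module.mem_support_iff_exists_annihilator.2 ⟨m, hp⟩
    exact hsupp this
  obtain ⟨n, hn⟩ := Ideal.exists_pow_le_of_le_radical_of_fg hle ha
  exact ⟨n, mem_torsionFiltration fun r hr ↦ (mem_annihilator_span_singleton m r).1 (hn hr)⟩

lemma exists_le_torsionFiltration {a : Ideal R} (hex : ∀ m : M, ∃ n, m ∈ torsionFiltration M a n)
    {N : Submodule R M} (hN : N.FG) : ∃ n, N ≤ torsionFiltration M a n := by
  obtain ⟨s, rfl⟩ := hN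
  choose g hg using hex
  exact ⟨s.sup g, span_le.2 fun m hm ↦ torsionFiltration_mono a (Finset.le_sup hm) (hg m)⟩

/-- The elements of `R` mapping the `(n + 1)`-st step of the torsion filtration into the `n`-th. -/
def torsionFiltrationIdeal (M : Type*) [AddCommGroup M] [Module R M] (a : Ideal R) (n : ℕ) :
    Ideal R where
  carrier := {r | ∀ m ∈ torsionFiltration M a (n + 1), r • m ∈ torsionFiltration M a n}
  add_mem' hr hs m hm := by
    rw [add_smul]
    exact add_mem (hr m hm) (hs m hm)
  zero_mem' m _ := by
    rw [zero_smul]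
    exact zero_mem _
  smul_mem' c r hr m hm := by
    rw [smul_eq_mul, mul_smul]
    exact smul_mem _ c (hr m hm)

lemma torsionFiltrationIdeal_mono (a : Ideal R) : Monotone (torsionFiltrationIdeal M a) := by
  refine monotone_nat_of_le_succ fun n r hr m hm x hx ↦ ?_
  rw [smul_comm]
  exact hr _ (hm x hx)

/-- Each factor from `J` lowers the filtration index by one, down to `n`. -/
lemma pow_smul_mem_torsionFiltration {a J : Ideal R} {n : ℕ}
    (hJ : ∀ k, n ≤ k → J ≤ torsionFiltrationIdeal M a k) {j : ℕ} {m : M}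
    (hm : m ∈ torsionFiltration M a (n + j)) : ∀ r ∈ J ^ j, r • m ∈ torsionFiltration M a n := by
  induction j generalizing m with
  | zero => exact fun r _ ↦ smul_mem _ r hm
  | succ j ih =>
    intro r hr
    rw [pow_succ] at hr
    refine Submodule.mul_induction_on hr (fun x hx y hy ↦ ?_) fun x y hx hy ↦ ?_
    · rw [mul_smul]
      exact ih (hJ (n + j) (by omega) hy m hm) x hx
    · rw [add_smul]
      exact add_mem hx hy

/-- If `M` is locally minimax and is exhausted by finitely generated steps of its torsion
filtration, then the eventual value of `torsionFiltrationIdeal` is only contained in maximal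
ideals. -/
lemma isMaximal_of_torsionFiltrationIdeal_le {a J : Ideal R} {n₀ : ℕ}
    (hM : IsLocallyMinimax R M) (hex : ∀ m : M, ∃ n, m ∈ torsionFiltration M a n)
    (hfg : ∀ n, (torsionFiltration M a n).FG)
    (hJ : ∀ k, n₀ ≤ k → torsionFiltrationIdeal M a k = J)
    {p : Ideal R} [hp : p.IsPrime] (hJp : J ≤ p) : p.IsMaximal := by
  obtain ⟨q, hq, hpq⟩ := p.exists_le_maximal hp.ne_top
  by_contra hmax
  obtain ⟨t, htq, htp⟩ : ∃ t ∈ q, t ∉ p := by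
    by_contra! hcon
    exact hmax (le_antisymm hpq hcon ▸ hq)
  obtain ⟨N, hN, hchain⟩ := (hM q).exists_fg_forall_antitone
  obtain ⟨n₁, hn₁⟩ := exists_le_torsionFiltration hex hN
  -- That is, `M_p = N_p`: the chain `N + R t ^ k z` becomes stationary at `q`, and as `t ∈ q`, the
  -- factor `u - c * t` stays outside `q`, hence outside `p`.
  have hloc (z : M) : ∃ u ∉ p, u • z ∈ N := by
    obtain ⟨n, hn⟩ := hchain (fun k ↦ N ⊔ span R {t ^ k • z})
      (antitone_nat_of_succ_le fun k ↦ sup_le_sup_left (by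
        rw [span_singleton_le_iff_mem, pow_succ', mul_smul]
        exact smul_mem _ t (mem_span_singleton_self _)) N) fun _ ↦ le_sup_left
    obtain ⟨u, hu, huz⟩ := hn (n + 1) n.le_succ (t ^ n • z)
      (mem_sup_right (mem_span_singleton_self _))
    obtain ⟨y, hy, w, hw, hyw⟩ := mem_sup.1 huz
    obtain ⟨c, rfl⟩ := mem_span_singleton.1 hw
    refine ⟨(u - c * t) * t ^ n, hp.mul_notMem (fun h ↦ hu ?_) fun h ↦ htp (hp.mem_of_pow_mem n h),
      ?_⟩
    · simpa using q.add_mem (hpq h) (q.mul_mem_left c htq)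
    · have : ((u - c * t) * t ^ n) • z = y := by
        rw [← sub_eq_iff_eq_add.2 hyw.symm]
        module
      rwa [this]
  let n := max n₀ n₁
  have hNn : N ≤ torsionFiltration M a n := hn₁.trans (torsionFiltration_mono a (le_max_right _ _))
  obtain ⟨s, hs⟩ := hfg (n + 1)
  choose u hup hu using hloc
  -- One element outside `p` moves all of `F (n + 1)` into `N ≤ F n`; it lies in `J ≤ p`, a
  -- contradiction.
  have hprod : ∏ z ∈ s, u z ∈ torsionFiltrationIdeal M a n := by
    intro m hm
    rw [← hs] at hm
    have : span R (s : Set M) ≤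
        (torsionFiltration M a n).comap (LinearMap.lsmul R M (∏ z ∈ s, u z)) := by
      refine span_le.2 fun z hz ↦ ?_
      obtain ⟨c, hc⟩ := Finset.dvd_prod_of_mem u (Finset.mem_coe.1 hz)
      change (∏ z ∈ s, u z) • z ∈ torsionFiltration M a n
      rw [hc, mul_comm, mul_smul]
      exact smul_mem _ c (hNn (hu z))
    exact this hm
  rw [hJ n (le_max_left _ _)] at hprod
  obtain ⟨z, -, hz⟩ := (Ideal.IsPrime.prod_mem_iff).1 (hJp hprod)
  exact hup z hz

/-- A locally minimax module exhausted by finitely generated steps of its torsion filtration has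
an Artinian quotient by one of these steps. -/
theorem exists_isArtinian_quotient_torsionFiltration [IsNoetherianRing R] {a : Ideal R}
    (hM : IsLocallyMinimax R M) (hex : ∀ m : M, ∃ n, m ∈ torsionFiltration M a n)
    (hfg : ∀ n, (torsionFiltration M a n).FG) :
    ∃ n, IsArtinian R (M ⧸ torsionFiltration M a n) := by
  obtain ⟨n₀, hn₀⟩ := monotone_stabilizes_iff_noetherian.2 (inferInstanceAs (IsNoetherian R R))
    ⟨torsionFiltrationIdeal M a, torsionFiltrationIdeal_mono a⟩
  set J := torsionFiltrationIdeal M a n₀ with hJdef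
  have hJ (k : ℕ) (hk : n₀ ≤ k) : torsionFiltrationIdeal M a k = J := (hn₀ k hk).symm
  have hmax {p : Ideal R} [p.IsPrime] (h : J ≤ p) : p.IsMaximal :=
    isMaximal_of_torsionFiltrationIdeal_le hM hex hfg hJ h
  have hfin : {q : Ideal R | q.IsMaximal ∧ J ≤ q}.Finite := by
    refine (Ideal.finite_minimalPrimes_of_isNoetherianRing R J).subset fun q ⟨hq, hJq⟩ ↦ ?_
    obtain ⟨p, hp, hpq⟩ := Ideal.exists_minimalPrimes_le hJq
    have := hp.1.1
    rwa [← (hmax hp.1.2).eq_of_le hq.ne_top hpq]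
  choose! N hN hchain using fun (q : Ideal R) (hq : q.IsMaximal) ↦
    (hM q).exists_fg_forall_antitone
  choose! b hb using fun (q : Ideal R) (hq : q.IsMaximal) ↦ exists_le_torsionFiltration hex (hN q hq)
  let n := max n₀ (hfin.toFinset.sup b)
  have hNn (q : Ideal R) (hq : q.IsMaximal) (hJq : J ≤ q) : N q ≤ torsionFiltration M a n :=
    (hb q hq).trans (torsionFiltration_mono a ((Finset.le_sup (hfin.mem_toFinset.2 ⟨hq, hJq⟩)).trans
      (le_max_right _ _)))
  refine ⟨n, monotone_stabilizes_iff_artinian.1 fun c ↦ ?_⟩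
  let B : ℕ → Submodule R M := fun k ↦ (OrderDual.ofDual (c k)).comap (mkQ _)
  have hB : Antitone B := fun i j hij ↦ comap_mono (c.monotone hij)
  have hnB (k : ℕ) : torsionFiltration M a n ≤ B k := fun m hm ↦ by
    rw [mem_comap, mkQ_apply, (Quotient.mk_eq_zero _).2 hm]
    exact zero_mem _
  choose! d hd using fun (q : Ideal R) (hq : q.IsMaximal ∧ J ≤ q) ↦
    hchain q hq.1 B hB fun k ↦ (hNn q hq.1 hq.2).trans (hnB k)
  refine ⟨hfin.toFinset.sup d, fun k hk ↦ ?_⟩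
  have heq : B (hfin.toFinset.sup d) = B k := by
    refine le_antisymm (fun z hz ↦ ?_) (hB hk)
    by_contra hzk
    -- The annihilator of `z` modulo `B k`. It contains a power of `J`, so a maximal ideal over it
    -- is one of the finitely many where the chain is already stationary.
    let I : Ideal R := (B k).comap (LinearMap.toSpanSingleton R M z)
    have hI : I ≠ ⊤ := fun h ↦ hzk (by
      have : (1 : R) ∈ I := h ▸ mem_top
      simpa [I] using this)
    obtain ⟨q, hq, hIq⟩ := I.exists_le_maximal hI
    obtain ⟨j, hj⟩ := hex z
    have hJI : J ^ j ≤ I := fun r hr ↦ hnB k <| pow_smul_mem_torsionFiltration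
      (fun i hi ↦ (hJ i ((le_max_left _ _).trans hi)).ge)
      (torsionFiltration_mono a (Nat.le_add_left j n) hj) r hr
    have hJq : J ≤ q := hq.isPrime.le_of_pow_le (hJI.trans hIq)
    have hdq : d q ≤ hfin.toFinset.sup d := Finset.le_sup (hfin.mem_toFinset.2 ⟨hq, hJq⟩)
    obtain ⟨u, hu, huz⟩ := hd q ⟨hq, hJq⟩ k (hdq.trans hk) z (hB hdq hz)
    exact hu (hIq huz)
  have := congrArg (Submodule.map (mkQ (torsionFiltration M a n))) heq
  simpa [B, map_comap_eq_of_surjective (mkQ_surjective _)] using this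

end Submodule

end TorsionFiltration

/-! ### Finiteness of `Ext` from `R ⧸ a` -/

section Ext

open Abelian

variable {R : Type u} [CommRing R]

/-- Linear maps out of `R ⧸ a` are the elements killed by `a`. -/
noncomputable def Submodule.torsionBySetEquivQuotientHom (a : Ideal R) (M : Type*)
    [AddCommGroup M] [Module R M] :
    torsionBySet R M (a : Set R) ≃ₗ[R] ((R ⧸ a) →ₗ[R] M) :=
  LinearEquiv.symm <| LinearEquiv.ofBijective
    (LinearMap.codRestrict _ (LinearMap.applyₗ (R := R) (Ideal.Quotient.mk a 1)) fun f ↦ by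
      rw [mem_torsionBySet_iff]
      rintro ⟨r, hr⟩
      change r • f (Ideal.Quotient.mk a 1) = 0
      rw [← map_smul, Algebra.smul_def, Ideal.Quotient.algebraMap_eq, ← map_mul, mul_one,
        Ideal.Quotient.eq_zero_iff_mem.2 hr,
        map_zero])
    ⟨fun f g h ↦ by
      have h' : f (Ideal.Quotient.mk a 1) = g (Ideal.Quotient.mk a 1) := congrArg Subtype.val h
      exact Submodule.linearMap_qext _ (LinearMap.ext_ring h'),
    fun m ↦ ⟨Submodule.liftQ a (LinearMap.toSpanSingleton R M (m : M)) fun r hr ↦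
      (mem_torsionBySet_iff _ _).1 m.2 ⟨r, hr⟩, Subtype.ext (by
        exact one_smul R (m : M))⟩⟩

lemma finite_ext_zero_iff {a : Ideal R} {M : Type u} [AddCommGroup M] [Module R M] :
    Module.Finite R (Ext.{u} (ModuleCat.of R (R ⧸ a)) (ModuleCat.of R M) 0) ↔
      (Submodule.torsionBySet R M (a : Set R)).FG := by
  rw [← Module.Finite.iff_fg]
  exact Module.Finite.equiv_iff ((Ext.linearEquiv₀.trans ModuleCat.homLinearEquiv).trans
    (Submodule.torsionBySetEquivQuotientHom a M).symm)

lemma smul_ext_quotient_eq_zero {a : Ideal R} {x : R} (hx : x ∈ a) {Y : ModuleCat.{u} R} {i : ℕ}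
    (α : Ext.{u} (ModuleCat.of R (R ⧸ a)) Y i) : x • α = 0 := by
  have h : x • 𝟙 (ModuleCat.of R (R ⧸ a)) = 0 := by
    ext
    change x • (Ideal.Quotient.mk a 1) = 0
    rw [Algebra.smul_def, Ideal.Quotient.algebraMap_eq, ← map_mul, mul_one]
    exact Ideal.Quotient.eq_zero_iff_mem.2 hx
  rw [← Ext.mk₀_id_comp α, ← Ext.smul_comp, ← Ext.mk₀_smul, h, Ext.mk₀_zero, Ext.zero_comp]

/-- Only the image in `Ext^i(X, X₃)` is assumed finite, because for `X₃ = xC` nothing more is known.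
-/
lemma finite_ext_X₂ [IsNoetherianRing R] {X : ModuleCat.{u} R} {S : ShortComplex (ModuleCat.{u} R)}
    (hS : S.ShortExact) {i : ℕ} (h₁ : Module.Finite R (Ext.{u} X S.X₁ i))
    (h₃ : Module.Finite R (LinearMap.range ((Ext.mk₀ S.g).postcompOfLinear R X (add_zero i)))) :
    Module.Finite R (Ext.{u} X S.X₂ i) := by
  have := isNoetherian_of_isNoetherianRing_of_finite R (Ext.{u} X S.X₁ i)
  have := isNoetherian_of_isNoetherianRing_of_finite R
    (LinearMap.range ((Ext.mk₀ S.g).postcompOfLinear R X (add_zero i)))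
  have : IsNoetherian R (Ext.{u} X S.X₂ i) := by
    refine isNoetherian_of_range_eq_ker ((Ext.mk₀ S.f).postcompOfLinear R X (add_zero i))
      ((Ext.mk₀ S.g).postcompOfLinear R X (add_zero i)).rangeRestrict ?_
    rw [LinearMap.ker_rangeRestrict]
    ext β
    constructor
    · rintro ⟨γ, rfl⟩
      simp
    · intro hβ
      exact Ext.covariant_sequence_exact₂ X hS β hβ
  infer_instance

/-- If `x ∈ a`, the module `Ext^i(R ⧸ a, C)` is finite as soon as `Ext^i(R ⧸ a, 0 :_C x)` and
`Ext^(i-1)(R ⧸ a, C ⧸ xC)` are finite. -/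
lemma finite_ext_of_ker_of_quotient [IsNoetherianRing R] {a : Ideal R} {x : R} (hx : x ∈ a)
    (C : Type u) [AddCommGroup C] [Module R C] (i : ℕ)
    (h₁ : ∀ (K : Type u) [AddCommGroup K] [Module R K] (ι : K →ₗ[R] C), Function.Injective ι →
      (∀ k : K, x • k = 0) → Module.Finite R (Ext.{u} (ModuleCat.of R (R ⧸ a)) (ModuleCat.of R K) i))
    (h₃ : ∀ (j : ℕ) (B : Submodule R C), j + 1 = i →
      Module.Finite R (Ext.{u} (ModuleCat.of R (R ⧸ a)) (ModuleCat.of R (C ⧸ B)) j)) :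
    Module.Finite R (Ext.{u} (ModuleCat.of R (R ⧸ a)) (ModuleCat.of R C) i) := by
  let X := ModuleCat.of R (R ⧸ a)
  let B := LinearMap.range (LinearMap.lsmul R C x)
  -- `xC` is written as `ker B.mkQ` so that the same object ends `0 :_C x → C → xC` and starts `xC →
  -- C → C ⧸ xC`.
  let g : C →ₗ[R] LinearMap.ker B.mkQ :=
    (LinearMap.lsmul R C x).codRestrict _ fun c ↦ by
      rw [Submodule.ker_mkQ]
      exact ⟨c, rfl⟩
  have hg : Function.Surjective g := by
    rintro ⟨c, hc⟩
    have hc' := hc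
    rw [Submodule.ker_mkQ] at hc'
    obtain ⟨b, rfl⟩ := hc'
    exact ⟨b, rfl⟩
  have hS := LinearMap.shortExact_shortComplexKer hg
  have hT := LinearMap.shortExact_shortComplexKer B.mkQ_surjective
  refine finite_ext_X₂ hS (h₁ _ (LinearMap.ker g).subtype Subtype.val_injective ?_) ?_
  · rintro ⟨k, hk⟩
    have hxk : x • k = 0 := congrArg Subtype.val (LinearMap.mem_ker.1 hk)
    exact Subtype.ext hxk
  -- The composite `C → xC → C` is multiplication by `x`, which is zero on `Ext(R ⧸ a, C)`.
  · have hle : LinearMap.range ((Ext.mk₀ g.shortComplexKer.g).postcompOfLinear R X (add_zero i)) ≤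
        LinearMap.ker
          ((Ext.mk₀ B.mkQ.shortComplexKer.f).postcompOfLinear R X (add_zero i)) := by
      rintro _ ⟨α, rfl⟩
      have hfac : g.shortComplexKer.g ≫ B.mkQ.shortComplexKer.f = x • 𝟙 (ModuleCat.of R C) := by
        ext c
        rfl
      change (α.comp (Ext.mk₀ g.shortComplexKer.g) (add_zero i)).comp
        (Ext.mk₀ B.mkQ.shortComplexKer.f) (add_zero i) = 0
      rw [Ext.comp_assoc_of_third_deg_zero, Ext.mk₀_comp_mk₀, hfac, ← Ext.smul_eq_comp_mk₀]
      exact smul_ext_quotient_eq_zero hx α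
    have hker : IsNoetherian R (LinearMap.ker
        ((Ext.mk₀ B.mkQ.shortComplexKer.f).postcompOfLinear R X (add_zero i))) := by
      cases i with
      | zero =>
        have hbot : LinearMap.ker
            ((Ext.mk₀ B.mkQ.shortComplexKer.f).postcompOfLinear R X (add_zero 0)) = ⊥ := by
          have := hT.mono_f
          exact LinearMap.ker_eq_bot.2 (Ext.postcomp_mk₀_injective_of_mono X _)
        rw [hbot]
        infer_instance
      | succ j =>
        have := h₃ j B rfl
        have := isNoetherian_of_isNoetherianRing_of_finite R (Ext.{u} X (ModuleCat.of R (C ⧸ B)) j)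
        refine isNoetherian_of_le (?_ : _ ≤ LinearMap.range (hT.extClass.postcompOfLinear R X rfl))
        intro β hβ
        exact Ext.covariant_sequence_exact₁ X hT β hβ rfl
    have := isNoetherian_of_le hle
    infer_instance

open Submodule in
/-- If `A` is Artinian and `0 :_A a` is finitely generated, then all `Ext^i(R ⧸ a, A)` are finitely
generated. -/
theorem finite_ext_quotient_of_isArtinian [IsNoetherianRing R] (a : Ideal R) (i : ℕ)
    (A : Type u) [AddCommGroup A] [Module R A] [IsArtinian R A]
    (h : IsNoetherian R (torsionBySet R A (a : Set R))) :
    Module.Finite R (Ext.{u} (ModuleCat.of R (R ⧸ a)) (ModuleCat.of R A) i) := by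
  induction i using Nat.strong_induction_on generalizing A with
  | _ i ih =>
  -- Artinian induction runs over images in `A`, while `K` stays abstract so that kernels of
  -- multiplication by `x` fit without transport.
  suffices H : ∀ (C : Submodule R A) (K : Type u) [AddCommGroup K] [Module R K] (ι : K →ₗ[R] A),
      Function.Injective ι → LinearMap.range ι = C →
      Module.Finite R (Ext.{u} (ModuleCat.of R (R ⧸ a)) (ModuleCat.of R K) i) from
    H _ A LinearMap.id Function.injective_id rfl
  intro C
  induction C using IsArtinian.induction with
  | _ C ihC =>
  intro K _ _ ι hι hC
  by_cases hK : ∀ x ∈ a, ∀ k : K, x • k = 0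
  · have : IsNoetherian R K := isNoetherian_of_injective
      (ι.codRestrict (torsionBySet R A (a : Set R)) fun k ↦ by
        rw [mem_torsionBySet_iff]
        rintro ⟨r, hr⟩
        change r • ι k = 0
        rw [← map_smul, hK r hr, map_zero])
      fun k l hkl ↦ hι (congrArg Subtype.val hkl)
    infer_instance
  · push Not at hK
    obtain ⟨x, hx, k, hk⟩ := hK
    have : IsArtinian R K := isArtinian_of_injective ι hι
    refine finite_ext_of_ker_of_quotient hx K i (fun L _ _ j hj hL ↦ ?_) fun j B hji ↦ ?_
    · refine ihC (LinearMap.range (ι ∘ₗ j)) (lt_of_le_of_ne ?_ ?_) L (ι ∘ₗ j) (hι.comp hj) rfl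
      · rw [← hC]
        exact LinearMap.range_comp_le_range j ι
      -- The kernel of `x` is proper because `x • k ≠ 0`.
      · intro heq
        have hmem : ι k ∈ LinearMap.range (ι ∘ₗ j) := by
          rw [heq, ← hC]
          exact ⟨k, rfl⟩
        obtain ⟨l, hl⟩ := hmem
        refine hk ?_
        rw [← hι hl, ← map_smul, hL, map_zero]
    · refine ih j (by omega) (K ⧸ B) (isNoetherian_torsionBySet_quotient
        (IsNoetherian.noetherian a) ?_ B)
      refine isNoetherian_of_injective
        ((ι.domRestrict (torsionBySet R K (a : Set R))).codRestrict
          (torsionBySet R A (a : Set R)) fun k ↦ ?_)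
        fun k l hkl ↦ Subtype.ext (hι (congrArg Subtype.val hkl))
      rw [mem_torsionBySet_iff]
      rintro r
      change (r : R) • ι k = 0
      rw [← map_smul, (mem_torsionBySet_iff _ _).1 k.2 r, map_zero]

end Ext

/-! ### The main theorem -/

theorem isCofinite_and_isMinimax_of_fg_torsionBySet {R : Type u} [CommRing R] [IsNoetherianRing R]
    {𝔞 : Ideal R} {M : Type u} [AddCommGroup M] [Module R M]
    (hsupp : Module.support R M ⊆ PrimeSpectrum.zeroLocus (𝔞 : Set R))
    (hM : IsLocallyMinimax R M) (h : (Submodule.torsionBySet R M (𝔞 : Set R)).FG) :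
    IsCofinite 𝔞 M ∧ IsMinimax R M := by
  have h𝔞 : 𝔞.FG := IsNoetherian.noetherian 𝔞
  have h' := isNoetherian_of_fg_of_noetherian _ h
  have hF := Submodule.isNoetherian_torsionFiltration h𝔞 h'
  obtain ⟨n, hn⟩ := Submodule.exists_isArtinian_quotient_torsionFiltration (a := 𝔞) hM
    (Submodule.exists_mem_torsionFiltration h𝔞 hsupp) fun n ↦
      Module.Finite.iff_fg.1 (have := hF n; inferInstance)
  set N := Submodule.torsionFiltration M 𝔞 n with hNdef
  have hN : IsNoetherian R N := hF n
  refine ⟨⟨hsupp, fun i ↦ ?_⟩, N, Module.Finite.iff_fg.1 inferInstance, hn⟩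
  have hq : IsNoetherian R (Submodule.torsionBySet R (M ⧸ N) (𝔞 : Set R)) := by
    have : IsNoetherian R (Submodule.smulColon (𝔞 : Set R) N) := hF (n + 1)
    rw [← Submodule.map_mkQ_smulColon]
    infer_instance
  have := finite_ext_quotient_of_isArtinian 𝔞 i (M ⧸ N) hq
  have := isNoetherian_of_isNoetherianRing_of_finite R
    (Abelian.Ext.{u} (ModuleCat.of R (R ⧸ 𝔞)) (ModuleCat.of R (M ⧸ N)) i)
  have : Module.Finite R (LinearMap.ker N.mkQ) := by
    rw [Submodule.ker_mkQ]
    infer_instance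
  refine finite_ext_X₂ (LinearMap.shortExact_shortComplexKer N.mkQ_surjective)
    (ModuleCat.finite_ext R _ (ModuleCat.of R (LinearMap.ker N.mkQ)) i) ?_
  have : IsNoetherian R (LinearMap.range ((Abelian.Ext.mk₀ N.mkQ.shortComplexKer.g).postcompOfLinear
      R (ModuleCat.of R (R ⧸ 𝔞)) (add_zero i))) :=
    isNoetherian_submodule' _
  infer_instance

theorem theorem2p6 {R : Type u} [CommRing R] [IsNoetherianRing R] (𝔞 : Ideal R)
    (M : Type u) [AddCommGroup M] [Module R M]
    (hsupp : Module.support R M ⊆ PrimeSpectrum.zeroLocus (𝔞 : Set R))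
    (hM : IsLocallyMinimax R M) :
    ((Submodule.torsionBySet R M (𝔞 : Set R)).FG → IsCofinite 𝔞 M ∧ IsMinimax R M) ∧
    ((∃ x ∈ 𝔞, IsCofinite 𝔞 (Submodule.torsionBy R M x)) →
      IsCofinite 𝔞 M ∧ IsMinimax R M) := by
  refine ⟨isCofinite_and_isMinimax_of_fg_torsionBySet hsupp hM, fun ⟨x, hx, hcof⟩ ↦
    isCofinite_and_isMinimax_of_fg_torsionBySet hsupp hM ?_⟩
  -- As `x ∈ 𝔞`, the elements of `0 :_M x` killed by `𝔞` are all of `0 :_M 𝔞`, so degree zero of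
  -- cofiniteness suffices.
  have hfg := (finite_ext_zero_iff.1 (hcof.2 0)).map (Submodule.torsionBy R M x).subtype
  convert hfg
  ext m
  constructor
  · intro hm
    rw [Submodule.mem_torsionBySet_iff] at hm
    exact ⟨⟨m, hm ⟨x, hx⟩⟩, (Submodule.mem_torsionBySet_iff _ _).2 fun r ↦ Subtype.ext (hm r), rfl⟩
  · rintro ⟨k, hk, rfl⟩
    exact (Submodule.mem_torsionBySet_iff _ _).2 fun r ↦
      congrArg Subtype.val ((Submodule.mem_torsionBySet_iff _ _).1 hk r)
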